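/- **Definitions.** All graphs are finite and simple, and $\ln$ is the natural logarithm. A *property* $\mathcal P$ assigns to each graph on a given vertex set the value "has $\mathcal P$" or "does not have $\mathcal P$"; it is *monotone increasing* if it is preserved by adding edges. For a graph $G$ and $0<p<1$, $\mathcal G(G,p)$ is the random subgraph of $G$ (on the same vertex set) that retains each edge of $G$ independently with probability $p$. The *local resilience* of a graph $G'$ with respect to $\mathcal P$ is the minimum $r\in[0,1]$ such that, by deleting from $G'$ a set of edges containing at most $r\,d_{G'}(v)$ edges at each vertex $v$, one can obtain a graph not having $\mathcal P$. (The minimum exists if the edgeless graph does not have $\mathcal P$. If the edgeless graph has $\mathcal P$, the local resilience is taken to be $0$.) For a sequence of graphs $G=(G_n)$ with $|V(G_n)|=n$, probabilities $p=p(n)$ with $0<p(n)<1$, and $0\le r\le1$, the property $\mathcal P$ is *$(G,p,r)$-resilient* if the probability that the local resilience of $\mathcal G(G_n,p(n))$ with respect to $\mathcal P$ is at least $r$ tends to $1$ as $n\to\infty$. The *$(1:b)$ Maker–Breaker game $\mathcal P(G)$* is played on the board $E(G)$. Breaker moves first, and the players alternate. In each move Breaker claims $b$ unclaimed edges and Maker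 claims one (a player claims all remaining edges if fewer than his quota are left). Maker wins if at some point he has claimed all edges of some edge-minimal subgraph of $G$ having $\mathcal P$. *Maker wins the game* means that he has a strategy which guarantees this against every strategy of Breaker. **Theorem 1.4.** Let $0<\varepsilon\le 1/100$. 1. Let $G=(G_n)$ be a sequence of graphs with $|V(G_n)|=n$, let $p=p(n)$ satisfy $0<p(n)<1$ for all $n$, and let $\mathcal P$ be a monotone increasing graph property which is $(G,p,\varepsilon)$-resilient. Then for all sufficiently large $n$: if the minimum degree satisfies $\delta(G_n)\ge \frac{10\ln n}{\varepsilon p(n)}$, then Maker wins the $\left(1:\left\lfloor \frac{\varepsilon}{20p(n)}\right\rfloor\right)$ game $\mathcal P(G_n)$. 2. How large $n$ has to be depends only on $\varepsilon$ and on the rate of convergence in the definition of resilience. That is, for every sequence $\eta(n)\to 0$ of real numbers there is an $n_0$ such that for every $n\ge n_0$, every graph $G$ on $n$ vertices, every $0<p<1$ and every monotone increasing property $\mathcal P$ of graphs on $V(G)$ the following holds. If $\delta(G)\ge\frac{10\ln n}{\varepsilon p}$, and $\mathcal G(G,p)$ has local resilience at least $\varepsilon$ with respect to $\mathcal P$ with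 probability at least $1-\eta(n)$, then Maker wins the $\left(1:\left\lfloor \frac{\varepsilon}{20p}\right\rfloor\right)$ game $\mathcal P(G)$. -/

import Mathlib

open Filter Topology MeasureTheory ProbabilityTheory

namespace MakerBreaker

/-! ### Biased Maker-Breaker games on a finite board

Breaker moves first.  A round consists of a move of Breaker followed by a move of Maker.  A player
with bias `c` claims exactly `c` unclaimed elements per move, or all the unclaimed elements if fewer
than `c` of them are left. -/

section Game

variable {α : Type*} [DecidableEq α]

/-- The record of the completed rounds, the most recent round first.  An entry is the pair
(set claimed by Breaker, set claimed by Maker). -/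
abbrev History (α : Type*) := List (Finset α × Finset α)

/-- All elements claimed by Breaker in the recorded rounds. -/
def breakerSet : History α → Finset α
  | [] => ∅
  | r :: h => r.1 ∪ breakerSet h

/-- All elements claimed by Maker in the recorded rounds. -/
def makerSet : History α → Finset α
  | [] => ∅
  | r :: h => r.2 ∪ makerSet h

/-- The elements of the board `X` that nobody has claimed yet. -/
def free (X : Finset α) (h : History α) : Finset α :=
  X \ (breakerSet h ∪ makerSet h)

/-- A strategy of Breaker (who opens each round) with bias `b` on the board `X`. -/
structure BreakerStrategy (X : Finset α) (b : ℕ) where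
  /-- the set claimed by Breaker after the history `h` -/
  move : History α → Finset α
  move_subset : ∀ h, move h ⊆ free X h
  card_move : ∀ h, (move h).card = min b (free X h).card

/-- A strategy of Maker (who answers Breaker's move in each round) with bias `a` on the
board `X`. -/
structure MakerStrategy (X : Finset α) (a : ℕ) where
  /-- the set claimed by Maker after the history `h`, when Breaker has just claimed `B` -/
  move : History α → Finset α → Finset α
  move_subset : ∀ h B, move h B ⊆ free X h \ B
  card_move : ∀ h B, (move h B).card = min a (free X h \ B).card

/-- The history of the first `k` rounds when the two given strategies are played against each
other. -/
def play {X : Finset α} {a b : ℕ} (σ : MakerStrategy X a) (τ : BreakerStrategy X b) :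
    ℕ → History α
  | 0 => []
  | k + 1 => (τ.move (play σ τ k), σ.move (play σ τ k) (τ.move (play σ τ k))) :: play σ τ k

/-- Maker, as the second player, wins the `(a : b)` game with board `X` and family of winning
sets `F`: he has a strategy which, against every strategy of Breaker, makes him occupy at some
point all the elements of some winning set. -/
def MakerWins (X : Finset α) (F : Set (Finset α)) (a b : ℕ) : Prop :=
  ∃ σ : MakerStrategy X a, ∀ τ : BreakerStrategy X b,
    ∃ k : ℕ, ∃ W ∈ F, W ⊆ makerSet (play σ τ k)

end Game

/-! ### Graph properties, games on graphs, random subgraphs and local resilience -/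

section Graphs

variable {V : Type*}

/-- The property `P` of graphs with vertex set `V` is monotone increasing: it is preserved by the
addition of edges. -/
def MonotoneIncreasing (P : SimpleGraph V → Prop) : Prop :=
  ∀ ⦃H K : SimpleGraph V⦄, H ≤ K → P H → P K

/-- The winning sets of the game `P(G)`: the edge sets of the edge-minimal subgraphs of `G` which
possess `P`. -/
def winningSets (P : SimpleGraph V → Prop) (G : SimpleGraph V) : Set (Finset (Sym2 V)) :=
  {W | ∃ H : SimpleGraph V, Minimal (fun K => K ≤ G ∧ P K) H ∧ (W : Set (Sym2 V)) = H.edgeSet}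

open scoped Classical in
/-- Maker has a winning strategy in the `(a : b)` game `P(G)`, played on the edge set of `G`. -/
noncomputable def MakerWinsOn [Fintype V] (P : SimpleGraph V → Prop) (G : SimpleGraph V)
    (a b : ℕ) : Prop :=
  MakerWins G.edgeFinset (winningSets P G) a b

/-- The law of the random subgraph of `G` which retains each edge of `G` independently with
probability `p`. -/
noncomputable def randomSubgraph (G : SimpleGraph V) (p : unitInterval) :
    Measure (SimpleGraph V) :=
  (setBernoulli G.edgeSet p).map SimpleGraph.fromEdgeSet

open scoped Classical in
/-- The ratios `0 ≤ r ≤ 1` for which `P` can be destroyed by deleting from `G` a set of edges (the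
edges of `H`) that contains at most `r * deg v` edges at each vertex `v`. -/
def destroyingRatios [Fintype V] (P : SimpleGraph V → Prop) (G : SimpleGraph V) : Set ℝ :=
  {r | 0 ≤ r ∧ r ≤ 1 ∧
    ∃ H : SimpleGraph V, H ≤ G ∧ (∀ v, (H.degree v : ℝ) ≤ r * G.degree v) ∧ ¬ P (G \ H)}

/-- The local resilience of `G` with respect to `P`.  The infimum is a minimum whenever the
edgeless graph does not have `P`, see `isLeast_localResilience`; otherwise a monotone increasing `P`
holds for all graphs on `V` and the value is `0` by convention. -/
noncomputable def localResilience [Fintype V] (P : SimpleGraph V → Prop) (G : SimpleGraph V) : ℝ :=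
  sInf (destroyingRatios P G)

lemma isLeast_localResilience [Fintype V] {P : SimpleGraph V → Prop} (hP : ¬ P ⊥)
    (G : SimpleGraph V) : IsLeast (destroyingRatios P G) (localResilience P G) := by
  classical
  have hne : (destroyingRatios P G).Nonempty :=
    ⟨1, by norm_num, le_refl _, G, le_refl _, fun v => by simp, by simpa using hP⟩
  have hbd : BddBelow (destroyingRatios P G) := ⟨0, fun r hr => hr.1⟩
  have hcl : IsClosed (destroyingRatios P G) := by
    have : destroyingRatios P G = ⋃ H ∈ {H : SimpleGraph V | H ≤ G ∧ ¬ P (G \ H)},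
        (Set.Icc 0 1 ∩ ⋂ v : V, {r : ℝ | (H.degree v : ℝ) ≤ r * G.degree v}) := by
      ext r
      simp only [destroyingRatios, Set.mem_ofPred_eq, Set.mem_iUnion, Set.mem_inter_iff,
        Set.mem_Icc, Set.mem_iInter, exists_prop]
      constructor
      · rintro ⟨h0, h1, H, hH, hd, hn⟩
        exact ⟨H, ⟨hH, hn⟩, ⟨h0, h1⟩, fun v => by convert hd v⟩
      · rintro ⟨H, ⟨hH, hn⟩, ⟨h0, h1⟩, hd⟩
        exact ⟨h0, h1, H, hH, fun v => by convert hd v, hn⟩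
    rw [this]
    refine Set.Finite.isClosed_biUnion (Set.toFinite _) fun H _ => ?_
    refine isClosed_Icc.inter (isClosed_iInter fun v => ?_)
    exact isClosed_le continuous_const (by fun_prop)
  exact ⟨hcl.csInf_mem hne hbd, fun r hr => csInf_le hbd hr⟩

/-- The probability that the local resilience with respect to `P` of the random subgraph of `G` with
edge probability `p` is at least `r`. -/
noncomputable def resilienceProb [Fintype V] (P : SimpleGraph V → Prop) (G : SimpleGraph V)
    (p : unitInterval) (r : ℝ) : ℝ :=
  (randomSubgraph G p).real {G' | r ≤ localResilience P G'}

end Graphs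

/-- `P` is `(G, p, r)`-resilient, for a sequence of graphs `G n` (where `G n` has `n` vertices) and
a sequence of probabilities `p n`: asymptotically almost surely, the local resilience with respect
to `P` of the random subgraph of `G n` with edge probability `p n` is at least `r`. -/
def IsResilient {V : ℕ → Type*} [∀ n, Fintype (V n)] (P : ∀ n, SimpleGraph (V n) → Prop)
    (G : ∀ n, SimpleGraph (V n)) (p : ℕ → unitInterval) (r : ℝ) : Prop :=
  Tendsto (fun n => resilienceProb (P n) (G n) (p n) r) atTop (𝓝 1)

end MakerBreaker

/-!
Maker wants to build a random subgraph of `G` with edge probability `p`, up to few missing edges at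
each vertex: if the random graph has local resilience `ε`, then what he owns still has `P`.
To this end he exposes the edges of `G` one by one, each being a success with probability `p`, and
claims the successes that Breaker has not taken.  A success is *wasted* if its edge is already
Breaker's when it is exposed.

In his move, Maker exposes edges at a vertex that still has unexposed edges and is in the greatest
danger, until he meets a success that he can claim.  The danger of `v` is
`d_C(v) - 3 * β * d_M(v)`, where `C` and `M` are the edges of Breaker and Maker and `β = ε / (20 * p)`
is at least Breaker's bias.  The sum of `exp (danger / (4 * β))` over the vertices with unexposed
edges never increases from round to round (`sum_exp_danger_le`).  So as long as an edge at `v` is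
unexposed, Breaker has only about `3 * β * d_M(v) + 4 * β * log n` edges at `v`, and this is at most
`ε * d_G(v) / 4` unless the random graph has an unusually large degree at `v`.  Hence at most
`ε * d_G(v) / 4` of the exposures at `v` concern Breaker's edges, and a Chernoff bound shows that
with high probability fewer than `3 / 5 * ε * p * d_G(v)` of them are successes.  That is less than
`9 / 10 * ε` times the degree of `v` in the random graph, which is rarely below
`2 / 3 * p * d_G(v)`.

The coin tosses are replaced by the method of conditional expectations.  `failureEstimate` bounds
the conditional probability of failure, given what has been exposed.  It does not depend on what the
players have claimed since, and each exposure is a fair step for it, so one of the two outcomes does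
not increase it.  Maker declares this outcome to be the result.  The estimate is less than `1` at the
start, by the resilience of the random graph and the three tail bounds `upperTail_le`,
`lowerTail_le` and `wastedTail_le`, and therefore also at the end, when it excludes a failure.  In
this way the strategy is deterministic and works against every strategy of Breaker.
-/

namespace MakerBreaker

/-! ### Winning by an invariant -/

section Invariant

variable {α : Type*} [DecidableEq α]

lemma card_free_cons_lt {X : Finset α} {h : History α} {B : Finset α} {e : α}
    (he : e ∈ free X h \ B) : (free X ((B, {e}) :: h)).card < (free X h).card := by
  refine Finset.card_lt_card (Finset.ssubset_iff_subset_ne.2 ⟨?_, fun heq => ?_⟩)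
  · intro x
    simp only [free, breakerSet, makerSet, Finset.mem_sdiff, Finset.mem_union]
    tauto
  · have : e ∈ free X ((B, {e}) :: h) := heq ▸ (Finset.mem_sdiff.1 he).1
    simp [free, breakerSet, makerSet] at this

/-- Maker wins the `(1 : b)` game if some invariant of histories holds at the start and can be
restored by Maker in every round in which he has not won yet.  Since the unclaimed part of the board
shrinks, the restoring cannot go on for ever. -/
theorem makerWins_of_invariant {X : Finset α} {F : Set (Finset α)} {b : ℕ}
    (I : History α → Prop) (h0 : I [])
    (hstep : ∀ h, I h → ∀ B ⊆ free X h, B.card ≤ b →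
      (∃ W ∈ F, W ⊆ makerSet h) ∨ ∃ e ∈ free X h \ B, I ((B, {e}) :: h)) :
    MakerWins X F 1 b := by
  classical
  -- A good answer is chosen when there is one, and an arbitrary legal move is made otherwise.
  have hmove : ∀ h B, ∃ m ⊆ free X h \ B, m.card = min 1 (free X h \ B).card ∧
      ((∃ e ∈ free X h \ B, I ((B, {e}) :: h)) →
        ∃ e ∈ free X h \ B, m = {e} ∧ I ((B, {e}) :: h)) := by
    intro h B
    by_cases hg : ∃ e ∈ free X h \ B, I ((B, {e}) :: h)
    · obtain ⟨e, he, hI⟩ := hg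
      have : 0 < (free X h \ B).card := Finset.card_pos.2 ⟨e, he⟩
      refine ⟨{e}, by simpa using he, ?_, fun _ => ⟨e, he, rfl, hI⟩⟩
      rw [Finset.card_singleton]; omega
    · obtain ⟨m, hm, hc⟩ := Finset.exists_subset_card_eq
        (min_le_right 1 (free X h \ B).card)
      exact ⟨m, hm, hc, fun h => (hg h).elim⟩
  choose mv hsub hcard hgood using hmove
  refine ⟨⟨mv, hsub, hcard⟩, fun τ => ?_⟩
  by_contra hlose
  push Not at hlose
  have hI : ∀ k, I (play ⟨mv, hsub, hcard⟩ τ k) ∧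
      (free X (play ⟨mv, hsub, hcard⟩ τ k)).card + k ≤ X.card := by
    intro k
    induction k with
    | zero => exact ⟨h0, Finset.card_le_card Finset.sdiff_subset⟩
    | succ k ih =>
      obtain ⟨hIk, hck⟩ := ih
      set h := play ⟨mv, hsub, hcard⟩ τ k with hh
      have hB : (τ.move h).card ≤ b := (τ.card_move h).trans_le (min_le_left _ _)
      rcases hstep h hIk _ (τ.move_subset h) hB with ⟨W, hW, hWs⟩ | hex
      · exact (hlose k W hW hWs).elim
      · obtain ⟨e, he, hm, hIe⟩ := hgood h _ hex
        have hp : play ⟨mv, hsub, hcard⟩ τ (k + 1) = (τ.move h, {e}) :: h := by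
          rw [play, ← hh, ← hm]
        rw [hp]
        exact ⟨hIe, by have := card_free_cons_lt he; omega⟩
  have := (hI (X.card + 1)).2
  omega

end Invariant

/-! ### Averages over random subsets of a finite set -/

section Average

variable {α : Type*} [DecidableEq α]

/-- The expectation of `g R` for the random subset `R` of the finite set `T` that contains each
element of `T` independently with probability `p`, written as a finite sum. -/
noncomputable def average (p : ℝ) (T : Finset α) (g : Finset α → ℝ) : ℝ :=
  ∑ R ∈ T.powerset, p ^ R.card * (1 - p) ^ (T \ R).card * g R

lemma average_empty (p : ℝ) (g : Finset α → ℝ) : average p ∅ g = g ∅ := by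
  simp [average]

lemma average_insert (p : ℝ) {T : Finset α} {e : α} (he : e ∉ T) (g : Finset α → ℝ) :
    average p (insert e T) g =
      (1 - p) * average p T g + p * average p T (fun R => g (insert e R)) := by
  rw [average, Finset.sum_powerset_insert he, average, average, Finset.mul_sum, Finset.mul_sum]
  congr 1 <;> refine Finset.sum_congr rfl fun R hR => ?_
  · have hR := Finset.mem_powerset.1 hR
    rw [Finset.insert_sdiff_of_notMem _ (fun h => he (hR h)),
      Finset.card_insert_of_notMem (fun h => he (Finset.mem_sdiff.1 h).1)]
    ring
  · have hR := Finset.mem_powerset.1 hR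
    rw [Finset.insert_sdiff_insert, Finset.card_insert_of_notMem (fun h => he (hR h)),
      Finset.sdiff_insert_of_notMem he]
    ring

lemma average_add (p : ℝ) (T : Finset α) (g₁ g₂ : Finset α → ℝ) :
    average p T (fun R => g₁ R + g₂ R) = average p T g₁ + average p T g₂ := by
  simp only [average, mul_add, Finset.sum_add_distrib]

lemma average_sum {ι : Type*} (p : ℝ) (T : Finset α) (s : Finset ι) (g : ι → Finset α → ℝ) :
    average p T (fun R => ∑ i ∈ s, g i R) = ∑ i ∈ s, average p T (g i) := by
  simp only [average, Finset.mul_sum]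
  exact Finset.sum_comm

lemma average_mul_const (p c : ℝ) (T : Finset α) (g : Finset α → ℝ) :
    average p T (fun R => g R * c) = average p T g * c := by
  simp only [average, Finset.sum_mul, mul_assoc]

lemma average_const (p c : ℝ) (T : Finset α) : average p T (fun _ => c) = c := by
  induction T using Finset.induction_on with
  | empty => rw [average_empty]
  | insert e T he ih => rw [average_insert p he, ih]; ring

lemma average_nonneg {p : ℝ} (h0 : 0 ≤ p) (h1 : p ≤ 1) {T : Finset α} {g : Finset α → ℝ}
    (hg : ∀ R ⊆ T, 0 ≤ g R) : 0 ≤ average p T g :=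
  Finset.sum_nonneg fun R hR => mul_nonneg
    (mul_nonneg (pow_nonneg h0 _) (pow_nonneg (by linarith) _)) (hg R (Finset.mem_powerset.1 hR))

lemma exists_lt_of_average_lt {p c : ℝ} (h0 : 0 ≤ p) (h1 : p ≤ 1) {T : Finset α}
    {g : Finset α → ℝ} (h : average p T g < c) : ∃ R ⊆ T, g R < c := by
  by_contra! hne
  have h2 := average_nonneg (g := fun R => g R + -c) h0 h1 (T := T)
    fun R hR => by linarith [hne R hR]
  rw [average_add, average_const] at h2
  linarith

end Average

/-! ### Degrees in a set of edges -/

section Degree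

variable {V : Type*} [DecidableEq V]

/-- The number of edges of `T` at the vertex `v`. -/
def edgeDegree (T : Finset (Sym2 V)) (v : V) : ℕ := (T.filter (v ∈ ·)).card

@[simp] lemma edgeDegree_empty (v : V) : edgeDegree (∅ : Finset (Sym2 V)) v = 0 := by
  simp [edgeDegree]

lemma edgeDegree_mono {S T : Finset (Sym2 V)} (h : S ⊆ T) (v : V) :
    edgeDegree S v ≤ edgeDegree T v :=
  Finset.card_le_card (Finset.filter_subset_filter _ h)

lemma edgeDegree_insert_of_mem {T : Finset (Sym2 V)} {e : Sym2 V} (he : e ∉ T) {v : V}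
    (hv : v ∈ e) : edgeDegree (insert e T) v = edgeDegree T v + 1 := by
  rw [edgeDegree, Finset.filter_insert, if_pos hv, Finset.card_insert_of_notMem (by simp [he]),
    edgeDegree]

lemma edgeDegree_insert_of_notMem {T : Finset (Sym2 V)} {e : Sym2 V} {v : V}
    (hv : v ∉ e) : edgeDegree (insert e T) v = edgeDegree T v := by
  rw [edgeDegree, Finset.filter_insert, if_neg hv, edgeDegree]

lemma edgeDegree_union_le (S T : Finset (Sym2 V)) (v : V) :
    edgeDegree (S ∪ T) v ≤ edgeDegree S v + edgeDegree T v := by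
  rw [edgeDegree, Finset.filter_union]
  exact Finset.card_union_le _ _

lemma edgeDegree_le_card (T : Finset (Sym2 V)) (v : V) : edgeDegree T v ≤ T.card :=
  Finset.card_filter_le _ _

lemma sum_edgeDegree_le [Fintype V] (T : Finset (Sym2 V)) :
    ∑ v, edgeDegree T v ≤ 2 * T.card := by
  simp only [edgeDegree, Finset.card_filter]
  rw [Finset.sum_comm, mul_comm, ← smul_eq_mul, ← Finset.sum_const]
  refine Finset.sum_le_sum fun e _ => ?_
  rw [← Finset.card_filter]
  induction e using Sym2.ind with
  | _ x y =>
    refine (Finset.card_le_card (t := {x, y}) fun v hv => ?_).trans Finset.card_le_two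
    simpa using hv

/-- The generating function of a binomial distribution: the degree of `v` in a random subset of `T`
is a sum of independent indicators. -/
lemma average_pow_edgeDegree (p c : ℝ) (T : Finset (Sym2 V)) (v : V) :
    average p T (fun R => c ^ edgeDegree R v) = (1 - p + p * c) ^ edgeDegree T v := by
  induction T using Finset.induction_on with
  | empty => simp [average_empty]
  | insert e T he ih =>
    rw [average_insert p he]
    by_cases hv : v ∈ e
    · have h : average p T (fun R => c ^ edgeDegree (insert e R) v) =
          average p T (fun R => c ^ edgeDegree R v * c) := by
        refine Finset.sum_congr rfl fun R hR => ?_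
        beta_reduce
        rw [edgeDegree_insert_of_mem (fun h => he (Finset.mem_powerset.1 hR h)) hv, pow_succ]
      rw [h, average_mul_const, ih, edgeDegree_insert_of_mem he hv, pow_succ]
      ring
    · simp only [edgeDegree_insert_of_notMem hv, ih]
      ring

end Degree

/-! ### The dangers of the vertices -/

section Danger

/-- One round of a box game, in terms of the exponential potential of the dangers `x`: if Breaker
increases them by the amounts `i` with total at most `2 * β`, and Maker then lowers by `3 * β` one
that has become largest, then the potential has not increased. -/
lemma sum_exp_danger_le {ι : Type*} {W : Finset ι} {x i y : ι → ℝ} {β : ℝ} {v : ι} (hβ : 0 < β)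
    (hi : ∀ u ∈ W, 0 ≤ i u) (hsum : ∑ u ∈ W, i u ≤ 2 * β) (hv : v ∈ W)
    (hmax : ∀ u ∈ W, x u + i u ≤ x v + i v) (hy : ∀ u ∈ W, y u ≤ x u + i u)
    (hyv : y v ≤ x v + i v - 3 * β) :
    ∑ u ∈ W, Real.exp (y u / (4 * β)) ≤ ∑ u ∈ W, Real.exp (x u / (4 * β)) := by
  classical
  set E := Real.exp ((x v + i v) / (4 * β)) with hE
  have hE0 : 0 < E := Real.exp_pos _
  have h34 : Real.exp (-(3 / 4)) ≤ 1 / 2 := by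
    rw [Real.exp_neg, one_div]
    refine inv_anti₀ (by norm_num) ?_
    have := Real.quadratic_le_exp_of_nonneg (show (0 : ℝ) ≤ 3 / 4 by norm_num)
    norm_num at this ⊢
    linarith
  have hB : ∀ u ∈ W, Real.exp ((x u + i u) / (4 * β)) ≤
      Real.exp (x u / (4 * β)) + i u / (4 * β) * E := by
    intro u hu
    have h1 : Real.exp ((x u + i u) / (4 * β)) ≤ E := by
      exact Real.exp_le_exp.2 (div_le_div_of_nonneg_right (hmax u hu) (by linarith))
    have h2 : 1 - i u / (4 * β) ≤ Real.exp (-(i u / (4 * β))) := by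
      have := Real.add_one_le_exp (-(i u / (4 * β))); linarith
    have h3 : Real.exp (x u / (4 * β)) =
        Real.exp ((x u + i u) / (4 * β)) * Real.exp (-(i u / (4 * β))) := by
      rw [← Real.exp_add]; congr 1; ring
    have h4 : 0 ≤ i u / (4 * β) := div_nonneg (hi u hu) (by linarith)
    have h5 := Real.exp_pos ((x u + i u) / (4 * β))
    rw [h3]
    nlinarith
  have hM : ∑ u ∈ W, Real.exp (y u / (4 * β)) ≤
      ∑ u ∈ W, (Real.exp ((x u + i u) / (4 * β)) - if u = v then E / 2 else 0) := by
    refine Finset.sum_le_sum fun u hu => ?_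
    split_ifs with huv
    · subst huv
      have : Real.exp (y u / (4 * β)) ≤ E * Real.exp (-(3 / 4)) := by
        rw [hE, ← Real.exp_add]
        gcongr
        rw [div_add' _ _ _ (by positivity)]
        exact div_le_div_of_nonneg_right (by linarith) (by linarith)
      rw [← hE]
      nlinarith
    · rw [sub_zero]
      gcongr
      exact hy u hu
  have hS : ∑ u ∈ W, Real.exp ((x u + i u) / (4 * β)) ≤
      ∑ u ∈ W, Real.exp (x u / (4 * β)) + E / 2 := by
    refine (Finset.sum_le_sum hB).trans ?_
    rw [Finset.sum_add_distrib, ← Finset.sum_mul, ← Finset.sum_div]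
    have : (∑ u ∈ W, i u) / (4 * β) ≤ 1 / 2 := by
      rw [div_le_iff₀ (by linarith)]; linarith
    nlinarith
  rw [Finset.sum_sub_distrib, Finset.sum_ite_eq' W v, if_pos hv] at hM
  linarith

end Danger

/-! ### Exposing the edges of a random graph during the game -/

section Exposure

variable {V : Type*} [DecidableEq V]

lemma average_sdiff_eq (p : ℝ) (f : Finset (Sym2 V) → ℝ) {X S A : Finset (Sym2 V)}
    {e : Sym2 V} (he : e ∈ X \ S) :
    average p (X \ S) (fun R => f (A ∪ R)) =
      (1 - p) * average p (X \ insert e S) (fun R => f (A ∪ R)) +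
        p * average p (X \ insert e S) (fun R => f (insert e A ∪ R)) := by
  have h : X \ S = insert e (X \ insert e S) := by
    ext x
    simp only [Finset.mem_sdiff, Finset.mem_insert] at he ⊢
    by_cases hx : x = e
    · subst hx; tauto
    · tauto
  rw [h, average_insert p (by simp)]
  simp only [Finset.union_insert, Finset.insert_union]

lemma wasted_weight_nonneg {p : ℝ} (h0 : 0 ≤ p) (K t : V → ℝ) (A Y : Finset (Sym2 V)) (v : V) :
    0 ≤ (2 : ℝ) ^ edgeDegree (A ∩ Y) v / (1 + p) ^ edgeDegree Y v *
      ((2 : ℝ) ^ (-t v) * (1 + p) ^ K v) := by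
  have : 0 < 1 + p := by linarith
  positivity

variable [Fintype V]

/-- The pessimistic estimate of the probability that Maker fails.  The edges in `S` have been
exposed, those in `A` successfully, and those in `Y` while they belonged to Breaker.  The first
summand is the conditional expectation of the penalty `f`; the summand of `v` bounds the conditional
probability that the number of successes among at most `K v` exposures of Breaker's edges at `v`
reaches `t v`. -/
noncomputable def failureEstimate (X : Finset (Sym2 V)) (p : ℝ) (f : Finset (Sym2 V) → ℝ)
    (K t : V → ℝ) (S A Y : Finset (Sym2 V)) : ℝ :=
  average p (X \ S) (fun R => f (A ∪ R)) +
    ∑ v, (2 : ℝ) ^ edgeDegree (A ∩ Y) v / (1 + p) ^ edgeDegree Y v *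
      ((2 : ℝ) ^ (-t v) * (1 + p) ^ K v)

/-- The states of the exposure during a game in which Maker and Breaker have claimed the edges in
`M` and `C`; see `failureEstimate` for the roles of `S`, `A` and `Y`. -/
structure IsExposure (X : Finset (Sym2 V)) (p : ℝ) (f : Finset (Sym2 V) → ℝ) (K t : V → ℝ)
    (M C S A Y : Finset (Sym2 V)) : Prop where
  exposed_subset : S ⊆ X
  success_subset : A ⊆ S
  wasted_subset : Y ⊆ S
  maker_subset : M ⊆ A
  subset_maker : A \ Y ⊆ M
  wasted_subset_breaker : Y ⊆ C
  edgeDegree_wasted_le : ∀ v, (edgeDegree Y v : ℝ) ≤ K v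
  estimate_lt_one : failureEstimate X p f K t S A Y < 1

variable {X : Finset (Sym2 V)} {p : ℝ} {f : Finset (Sym2 V) → ℝ} {K t : V → ℝ}
  {M C S A Y : Finset (Sym2 V)}

/-- The exposure of an edge that is not Breaker's is a fair step for the estimate. -/
lemma failureEstimate_eq_of_free {e : Sym2 V} (he : e ∈ X \ S) (hYS : Y ⊆ S) :
    failureEstimate X p f K t S A Y =
      (1 - p) * failureEstimate X p f K t (insert e S) A Y +
        p * failureEstimate X p f K t (insert e S) (insert e A) Y := by
  have heY : e ∉ Y := fun h => (Finset.mem_sdiff.1 he).2 (hYS h)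
  rw [failureEstimate, failureEstimate, failureEstimate, average_sdiff_eq p f he,
    Finset.insert_inter_of_notMem heY]
  ring

/-- The exposure of one of Breaker's edges is a fair step for the estimate. -/
lemma failureEstimate_eq_of_breaker (hp : 0 ≤ p) {e : Sym2 V} (he : e ∈ X \ S) (hAS : A ⊆ S)
    (hYS : Y ⊆ S) :
    failureEstimate X p f K t S A Y =
      (1 - p) * failureEstimate X p f K t (insert e S) A (insert e Y) +
        p * failureEstimate X p f K t (insert e S) (insert e A) (insert e Y) := by
  have heY : e ∉ Y := fun h => (Finset.mem_sdiff.1 he).2 (hYS h)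
  have heA : e ∉ A := fun h => (Finset.mem_sdiff.1 he).2 (hAS h)
  have h1 : A ∩ insert e Y = A ∩ Y := by
    rw [Finset.inter_insert_of_notMem heA]
  have h2 : insert e A ∩ insert e Y = insert e (A ∩ Y) := by
    rw [Finset.insert_inter_distrib]
  rw [failureEstimate, failureEstimate, failureEstimate, average_sdiff_eq p f he, h1, h2, mul_add,
    mul_add, Finset.mul_sum, Finset.mul_sum, add_add_add_comm, ← Finset.sum_add_distrib]
  congr 1
  refine Finset.sum_congr rfl fun v _ => ?_
  by_cases hv : v ∈ e
  · rw [edgeDegree_insert_of_mem heY hv, edgeDegree_insert_of_mem (by simp [heA]) hv]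
    have : (1 + p) ≠ 0 := by positivity
    -- `((1 - p) + 2 * p) / (1 + p) = 1`
    field_simp
    ring
  · rw [edgeDegree_insert_of_notMem hv, edgeDegree_insert_of_notMem hv]
    ring

lemma lt_one_or_lt_one_of_eq {a b c : ℝ} (h0 : 0 ≤ p) (h1 : p ≤ 1)
    (h : a = (1 - p) * b + p * c) (ha : a < 1) : b < 1 ∨ c < 1 := by
  by_contra! hbc
  nlinarith [hbc.1, hbc.2]

lemma IsExposure.expose_breaker (hI : IsExposure X p f K t M C S A Y) (h0 : 0 ≤ p) (h1 : p ≤ 1)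
    {e : Sym2 V} (he : e ∈ X \ S) (heC : e ∈ C)
    (hK : ∀ v ∈ e, (edgeDegree C v : ℝ) ≤ K v) :
    ∃ A', IsExposure X p f K t M C (insert e S) A' (insert e Y) := by
  have hX : insert e S ⊆ X := Finset.insert_subset (Finset.mem_sdiff.1 he).1 hI.exposed_subset
  have hYC : insert e Y ⊆ C := Finset.insert_subset heC hI.wasted_subset_breaker
  have hYK : ∀ v, (edgeDegree (insert e Y) v : ℝ) ≤ K v := by
    intro v
    by_cases hv : v ∈ e
    · exact (Nat.cast_le.2 (edgeDegree_mono hYC v)).trans (hK v hv)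
    · rw [edgeDegree_insert_of_notMem hv]; exact hI.edgeDegree_wasted_le v
  have hYS := Finset.insert_subset_insert e hI.wasted_subset
  have hsub : (insert e A) \ (insert e Y) ⊆ A \ Y := by
    intro x; simp only [Finset.mem_sdiff, Finset.mem_insert]; tauto
  rcases lt_one_or_lt_one_of_eq h0 h1
    (failureEstimate_eq_of_breaker h0 he hI.success_subset hI.wasted_subset)
    hI.estimate_lt_one with h | h
  · exact ⟨A, hX, hI.success_subset.trans (Finset.subset_insert _ _), hYS, hI.maker_subset,
      (Finset.sdiff_subset_sdiff (Finset.subset_insert _ _) le_rfl).trans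
        (hsub.trans hI.subset_maker), hYC, hYK, h⟩
  · exact ⟨insert e A, hX, Finset.insert_subset_insert e hI.success_subset, hYS,
      hI.maker_subset.trans (Finset.subset_insert _ _), hsub.trans hI.subset_maker, hYC, hYK, h⟩

lemma IsExposure.expose_free (hI : IsExposure X p f K t M C S A Y) (h0 : 0 ≤ p) (h1 : p ≤ 1)
    {e : Sym2 V} (he : e ∈ X \ S) :
    IsExposure X p f K t M C (insert e S) A Y ∨
      IsExposure X p f K t (insert e M) C (insert e S) (insert e A) Y := by
  have hX : insert e S ⊆ X := Finset.insert_subset (Finset.mem_sdiff.1 he).1 hI.exposed_subset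
  have hYS := hI.wasted_subset.trans (Finset.subset_insert e S)
  rcases lt_one_or_lt_one_of_eq h0 h1
    (failureEstimate_eq_of_free he hI.wasted_subset) hI.estimate_lt_one with h | h
  · exact .inl ⟨hX, hI.success_subset.trans (Finset.subset_insert _ _), hYS, hI.maker_subset,
      hI.subset_maker, hI.wasted_subset_breaker, hI.edgeDegree_wasted_le, h⟩
  · refine .inr ⟨hX, Finset.insert_subset_insert e hI.success_subset, hYS,
      Finset.insert_subset_insert e hI.maker_subset, ?_, hI.wasted_subset_breaker,
      hI.edgeDegree_wasted_le, h⟩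
    intro x hx
    by_cases hxe : x = e
    · simp [hxe]
    · refine Finset.mem_insert_of_mem (hI.subset_maker ?_)
      simp only [Finset.mem_sdiff, Finset.mem_insert, hxe, false_or] at hx ⊢
      exact hx

/-- Some completion of the exposed part has penalty less than `1`. -/
lemma IsExposure.exists_completion (hI : IsExposure X p f K t M C S A Y) (h0 : 0 ≤ p)
    (h1 : p ≤ 1) : ∃ R ⊆ X \ S, f (A ∪ R) < 1 := by
  refine exists_lt_of_average_lt (g := fun R => f (A ∪ R)) h0 h1
    (lt_of_le_of_lt ?_ hI.estimate_lt_one)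
  exact le_add_of_nonneg_right (Finset.sum_nonneg fun v _ => wasted_weight_nonneg h0 K t A Y v)

lemma IsExposure.edgeDegree_wasted_success_lt (hI : IsExposure X p f K t M C S A Y) (h0 : 0 ≤ p)
    (h1 : p ≤ 1) (hf : ∀ A, 0 ≤ f A) (v : V) : (edgeDegree (A ∩ Y) v : ℝ) < t v := by
  have hp : 0 < 1 + p := by linarith
  have h2 : (2 : ℝ) ^ edgeDegree (A ∩ Y) v / (1 + p) ^ edgeDegree Y v *
      ((2 : ℝ) ^ (-t v) * (1 + p) ^ K v) < 1 := by
    refine lt_of_le_of_lt ?_ hI.estimate_lt_one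
    refine (Finset.single_le_sum (f := fun v => (2 : ℝ) ^ edgeDegree (A ∩ Y) v /
      (1 + p) ^ edgeDegree Y v * ((2 : ℝ) ^ (-t v) * (1 + p) ^ K v))
      (fun v _ => wasted_weight_nonneg h0 K t A Y v) (Finset.mem_univ v)).trans ?_
    exact le_add_of_nonneg_left (average_nonneg h0 h1 fun R _ => hf _)
  have h3 : (1 + p) ^ edgeDegree Y v ≤ (1 + p) ^ K v := by
    rw [← Real.rpow_natCast]
    exact Real.rpow_le_rpow_of_exponent_le (by linarith) (hI.edgeDegree_wasted_le v)
  have h4 : (2 : ℝ) ^ ((edgeDegree (A ∩ Y) v : ℝ) - t v) < 1 := by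
    refine lt_of_le_of_lt ?_ h2
    rw [sub_eq_add_neg, Real.rpow_add two_pos, Real.rpow_natCast, div_mul_eq_mul_div,
      le_div_iff₀ (by positivity), ← mul_assoc]
    gcongr
  by_contra! hge
  exact absurd h4 (not_lt.2 (Real.one_le_rpow one_le_two (by linarith)))

end Exposure

/-! ### Maker's strategy -/

section Strategy

variable {V : Type*} [Fintype V] [DecidableEq V]

/-- The vertices with an edge that has not been exposed. -/
def activeVertices (X S : Finset (Sym2 V)) : Finset V :=
  Finset.univ.filter fun v => ∃ e ∈ X \ S, v ∈ e

/-- The danger of the vertex `v` when Maker and Breaker have claimed the edges in `M` and `C`.  The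
real number `β > 0` is an upper bound for Breaker's bias, which may be `0`. -/
def danger (β : ℝ) (M C : Finset (Sym2 V)) (v : V) : ℝ :=
  edgeDegree C v - 3 * β * edgeDegree M v

variable {X : Finset (Sym2 V)} {p β : ℝ} {f : Finset (Sym2 V) → ℝ} {K t D : V → ℝ}

lemma activeVertices_anti {S S' : Finset (Sym2 V)} (h : S ⊆ S') :
    activeVertices X S' ⊆ activeVertices X S := by
  intro v
  simp only [activeVertices, Finset.mem_filter, Finset.mem_univ, true_and, Finset.mem_sdiff]
  rintro ⟨e, ⟨heX, heS⟩, hv⟩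
  exact ⟨e, ⟨heX, fun h' => heS (h h')⟩, hv⟩

/-- At an active vertex Breaker has few edges: its danger is bounded by the potential, and Maker's
degree by the penalty `f`. -/
lemma IsExposure.edgeDegree_breaker_le {M C B S A Y : Finset (Sym2 V)} {b : ℕ}
    (hI : IsExposure X p f K t M (C ∪ B) S A Y) (h0 : 0 ≤ p) (h1 : p ≤ 1) (hβ : 0 < β)
    (hb : (b : ℝ) ≤ β) (hB : B.card ≤ b)
    (hfD : ∀ A ⊆ X, f A < 1 → ∀ v, (edgeDegree A v : ℝ) ≤ D v)
    (hK : ∀ v, 4 * β * Real.log (Fintype.card V) + β + 3 * β * D v ≤ K v)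
    (hpot : ∑ v ∈ activeVertices X S, Real.exp (danger β M C v / (4 * β)) ≤ Fintype.card V)
    {v : V} (hv : v ∈ activeVertices X S) : (edgeDegree (C ∪ B) v : ℝ) ≤ K v := by
  obtain ⟨R, hR, hfR⟩ := hI.exists_completion h0 h1
  have hM : (edgeDegree M v : ℝ) ≤ D v := by
    refine le_trans (Nat.cast_le.2 (edgeDegree_mono ?_ v)) (hfD (A ∪ R) ?_ hfR v)
    · exact hI.maker_subset.trans Finset.subset_union_left
    · exact Finset.union_subset (hI.success_subset.trans hI.exposed_subset)
        (hR.trans Finset.sdiff_subset)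
  have hd : danger β M C v ≤ 4 * β * Real.log (Fintype.card V) := by
    have h2 := (Finset.single_le_sum (f := fun v => Real.exp (danger β M C v / (4 * β)))
      (fun v _ => (Real.exp_pos _).le) hv).trans hpot
    have h3 := Real.log_le_log (Real.exp_pos _) h2
    rw [Real.log_exp, div_le_iff₀ (by linarith)] at h3
    linarith
  have hC : (edgeDegree (C ∪ B) v : ℝ) ≤ edgeDegree C v + β := by
    have h2 := (edgeDegree_union_le C B v).trans
      (Nat.add_le_add_left ((edgeDegree_le_card B v).trans hB) _)
    have h3 : (edgeDegree (C ∪ B) v : ℝ) ≤ edgeDegree C v + b := by exact_mod_cast h2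
    linarith
  have := hK v
  have hmul : 3 * β * (edgeDegree M v : ℝ) ≤ 3 * β * D v := by gcongr
  rw [danger] at hd
  linarith

/-- Maker's answer to the move `B` of Breaker: he exposes edges at active vertices of maximal danger
until everything is exposed or an unclaimed edge is a success, and claims this edge. -/
lemma IsExposure.answer {M C B : Finset (Sym2 V)} {b : ℕ} (h0 : 0 ≤ p) (h1 : p ≤ 1) (hβ : 0 < β)
    (hb : (b : ℝ) ≤ β) (hB : B.card ≤ b)
    (hfD : ∀ A ⊆ X, f A < 1 → ∀ v, (edgeDegree A v : ℝ) ≤ D v)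
    (hK : ∀ v, 4 * β * Real.log (Fintype.card V) + β + 3 * β * D v ≤ K v)
    {S A Y : Finset (Sym2 V)} (hI : IsExposure X p f K t M (C ∪ B) S A Y)
    (hpot : ∑ v ∈ activeVertices X S, Real.exp (danger β M C v / (4 * β)) ≤ Fintype.card V) :
    (∃ A Y, IsExposure X p f K t M (C ∪ B) X A Y) ∨
      ∃ e ∈ X \ (C ∪ B ∪ M), ∃ S A Y, IsExposure X p f K t (insert e M) (C ∪ B) S A Y ∧
        ∑ v ∈ activeVertices X S, Real.exp (danger β (insert e M) (C ∪ B) v / (4 * β)) ≤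
          Fintype.card V := by
  induction hn : (X \ S).card using Nat.strong_induction_on generalizing S A Y with
  | _ n ih =>
  subst hn
  -- the potential over the active vertices can only drop while edges are exposed
  have hpot' : ∀ e, ∑ v ∈ activeVertices X (insert e S), Real.exp (danger β M C v / (4 * β)) ≤
      Fintype.card V := fun e =>
    (Finset.sum_le_sum_of_subset_of_nonneg (activeVertices_anti (Finset.subset_insert e S))
      fun v _ _ => (Real.exp_pos _).le).trans hpot
  have hlt : ∀ e ∈ X \ S, (X \ insert e S).card < (X \ S).card := fun e he =>
    Finset.card_lt_card (Finset.ssubset_iff_subset_ne.2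
      ⟨Finset.sdiff_subset_sdiff le_rfl (Finset.subset_insert _ _), fun h => by
        rw [← h] at he; simp at he⟩)
  rcases (activeVertices X S).eq_empty_or_nonempty with hemp | hne
  · have hSX : S = X := by
      refine hI.exposed_subset.antisymm fun e he => ?_
      by_contra heS
      have hv := (Sym2.out_fst_mem e)
      have : (Quot.out e).1 ∈ activeVertices X S := by
        simp only [activeVertices, Finset.mem_filter, Finset.mem_univ, true_and]
        exact ⟨e, Finset.mem_sdiff.2 ⟨he, heS⟩, hv⟩
      simp [hemp] at this
    subst hSX
    exact .inl ⟨A, Y, hI⟩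
  obtain ⟨v, hv, hmax⟩ := Finset.exists_max_image _ (danger β M (C ∪ B)) hne
  obtain ⟨e, he, hve⟩ := (Finset.mem_filter.1 hv).2
  have heact : ∀ u ∈ e, u ∈ activeVertices X S := fun u hu =>
    Finset.mem_filter.2 ⟨Finset.mem_univ _, e, he, hu⟩
  by_cases heC : e ∈ C ∪ B
  · obtain ⟨A', hI'⟩ := hI.expose_breaker h0 h1 he heC fun u hu =>
      hI.edgeDegree_breaker_le h0 h1 hβ hb hB hfD hK hpot (heact u hu)
    exact ih _ (hlt e he) hI' (hpot' e) rfl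
  rcases hI.expose_free h0 h1 he with hI' | hI'
  · exact ih _ (hlt e he) hI' (hpot' e) rfl
  have heM : e ∉ M := fun h =>
    (Finset.mem_sdiff.1 he).2 (hI.success_subset (hI.maker_subset h))
  refine .inr ⟨e, ?_, _, _, _, hI', ?_⟩
  · rw [Finset.mem_sdiff, Finset.mem_union]
    exact ⟨(Finset.mem_sdiff.1 he).1, not_or.2 ⟨heC, heM⟩⟩
  refine ((Finset.sum_le_sum_of_subset_of_nonneg
    (activeVertices_anti (Finset.subset_insert e S)) fun v _ _ => (Real.exp_pos _).le).trans
    ?_).trans hpot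
  have hmono : ∀ u, (edgeDegree C u : ℝ) ≤ edgeDegree (C ∪ B) u := fun u =>
    Nat.cast_le.2 (edgeDegree_mono Finset.subset_union_left u)
  have hinc : ∀ u, (edgeDegree (C ∪ B) u : ℝ) - edgeDegree C u ≤ edgeDegree B u := fun u => by
    have : (edgeDegree (C ∪ B) u : ℝ) ≤ edgeDegree C u + edgeDegree B u := by
      exact_mod_cast edgeDegree_union_le C B u
    linarith
  have hadd : ∀ u, danger β M C u + ((edgeDegree (C ∪ B) u : ℝ) - edgeDegree C u) =
      danger β M (C ∪ B) u := fun u => by rw [danger, danger]; ring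
  refine sum_exp_danger_le (i := fun u => (edgeDegree (C ∪ B) u : ℝ) - edgeDegree C u) hβ
    (fun u _ => sub_nonneg.2 (hmono u)) ?_ hv ?_ ?_ ?_
  · calc ∑ u ∈ activeVertices X S, ((edgeDegree (C ∪ B) u : ℝ) - edgeDegree C u)
        ≤ ∑ u ∈ activeVertices X S, (edgeDegree B u : ℝ) := Finset.sum_le_sum fun u _ => hinc u
      _ ≤ ∑ u, (edgeDegree B u : ℝ) :=
        Finset.sum_le_sum_of_subset_of_nonneg (Finset.subset_univ _) fun u _ _ => by positivity
      _ ≤ 2 * (B.card : ℝ) := by exact_mod_cast sum_edgeDegree_le B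
      _ ≤ 2 * β := by
        have : (B.card : ℝ) ≤ b := by exact_mod_cast hB
        linarith
  · intro u hu
    rw [hadd, hadd]
    exact hmax u hu
  · intro u _
    rw [hadd, danger, danger]
    have : (edgeDegree M u : ℝ) ≤ edgeDegree (insert e M) u :=
      Nat.cast_le.2 (edgeDegree_mono (Finset.subset_insert _ _) u)
    have := mul_le_mul_of_nonneg_left this (show 0 ≤ 3 * β by linarith)
    linarith
  · rw [hadd, danger, danger, edgeDegree_insert_of_mem heM hve]
    push_cast
    linarith

/-- If the initial estimate is less than `1`, then Maker can play so that in the end he owns all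
edges of a graph with penalty less than `1`, except for fewer than `t v` of them at each vertex `v`.
So he wins if this suffices. -/
theorem makerWins_of_failureEstimate_lt_one {F : Set (Finset (Sym2 V))} {b : ℕ} (h0 : 0 ≤ p)
    (h1 : p ≤ 1) (hβ : 0 < β) (hb : (b : ℝ) ≤ β) (hf : ∀ A, 0 ≤ f A)
    (hD : ∀ v, 0 ≤ D v) (hfD : ∀ A ⊆ X, f A < 1 → ∀ v, (edgeDegree A v : ℝ) ≤ D v)
    (hK : ∀ v, 4 * β * Real.log (Fintype.card V) + β + 3 * β * D v ≤ K v)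
    (hest : failureEstimate X p f K t ∅ ∅ ∅ < 1)
    (hwin : ∀ A Y, A ⊆ X → f A < 1 → (∀ v, (edgeDegree (A ∩ Y) v : ℝ) < t v) →
      ∃ W ∈ F, W ⊆ A \ Y) :
    MakerWins X F 1 b := by
  have hlog : 0 ≤ Real.log (Fintype.card V) := Real.log_natCast_nonneg _
  refine makerWins_of_invariant (fun h => ∃ S A Y,
    IsExposure X p f K t (makerSet h) (breakerSet h) S A Y ∧
    ∑ v ∈ activeVertices X S, Real.exp (danger β (makerSet h) (breakerSet h) v / (4 * β)) ≤
      Fintype.card V) ⟨∅, ∅, ∅, ?_, ?_⟩ ?_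
  · refine ⟨by simp, by simp, by simp, by simp [makerSet], by simp, by simp, fun v => ?_, hest⟩
    have := hD v
    rw [edgeDegree_empty, Nat.cast_zero]
    refine le_trans ?_ (hK v)
    positivity
  · simp only [danger, makerSet, breakerSet, edgeDegree_empty]
    simpa using Finset.card_le_univ (activeVertices X ∅)
  · rintro h ⟨S, A, Y, hI, hpot⟩ B - hBb
    have hI' : IsExposure X p f K t (makerSet h) (breakerSet h ∪ B) S A Y :=
      { hI with
        wasted_subset_breaker := hI.wasted_subset_breaker.trans Finset.subset_union_left }
    rcases hI'.answer h0 h1 hβ hb hBb hfD hK hpot with ⟨A, Y, hX⟩ | ⟨e, he, S, A, Y, hS, hp⟩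
    · left
      obtain ⟨R, hR, hfR⟩ := hX.exists_completion h0 h1
      rw [Finset.sdiff_self, Finset.subset_empty] at hR
      rw [hR, Finset.union_empty] at hfR
      obtain ⟨W, hW, hWA⟩ := hwin A Y hX.success_subset hfR
        (hX.edgeDegree_wasted_success_lt h0 h1 hf)
      exact ⟨W, hW, hWA.trans hX.subset_maker⟩
    · right
      refine ⟨e, ?_, S, A, Y, ?_, ?_⟩
      · simp only [free, Finset.mem_sdiff, Finset.mem_union, not_or] at he ⊢
        tauto
      · simpa only [makerSet, breakerSet, Finset.union_comm B, Finset.singleton_union] using hS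
      · simpa only [makerSet, breakerSet, Finset.union_comm B, Finset.singleton_union] using hp

end Strategy

/-! ### Random subgraphs and local resilience -/

section RandomSubgraph

variable {V : Type*}

/-- Stated for an arbitrary `Fintype` instance, since the instances in `minDegree` and
`destroyingRatios` differ. -/
lemma degree_eq_edgeDegree [DecidableEq V] {H : SimpleGraph V} {T : Finset (Sym2 V)}
    (h : (T : Set (Sym2 V)) = H.edgeSet) (v : V) [Fintype (H.neighborSet v)] :
    H.degree v = edgeDegree T v := by
  rw [← SimpleGraph.card_incidenceFinset_eq_degree, edgeDegree]
  congr 1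
  ext e
  rw [SimpleGraph.mem_incidenceFinset, SimpleGraph.incidenceSet, ← h]
  simp

lemma edgeSet_fromEdgeSet_of_subset {G : SimpleGraph V} {T : Set (Sym2 V)} (hT : T ⊆ G.edgeSet) :
    (SimpleGraph.fromEdgeSet T).edgeSet = T := by
  rw [SimpleGraph.edgeSet_fromEdgeSet]
  refine sdiff_eq_left.2 (Set.disjoint_left.2 fun e he hd => ?_)
  exact G.not_isDiag_of_mem_edgeSet (hT he) (by simpa using hd)

variable [Fintype V]

lemma randomSubgraph_real_eq_average [DecidableEq V] {G : SimpleGraph V} {X : Finset (Sym2 V)}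
    (hX : (X : Set (Sym2 V)) = G.edgeSet) (p : unitInterval) (Q : SimpleGraph V → Prop)
    [DecidablePred Q] :
    (randomSubgraph G p).real {G' | Q G'} = average (p : ℝ) X
      (fun R => if Q (SimpleGraph.fromEdgeSet R) then 1 else 0) := by
  classical
  have hQ : MeasurableSet {G' : SimpleGraph V | Q G'} := by
    refine ⟨SimpleGraph.Adj '' {G' | Q G'}, (Set.toFinite _).measurableSet, ?_⟩
    exact Set.preimage_image_eq _ fun _ _ h => SimpleGraph.ext h
  rw [randomSubgraph, map_measureReal_apply SimpleGraph.measurable_fromEdgeSet hQ, measureReal_def,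
    setBernoulli_apply_eq_apply_subsets, ← measureReal_def, ← hX]
  have hset : {s | s ∈ SimpleGraph.fromEdgeSet ⁻¹' {G' : SimpleGraph V | Q G'} ∧ s ⊆ ↑X} =
      ⋃ R ∈ X.powerset.filter
          (fun R : Finset (Sym2 V) => Q (SimpleGraph.fromEdgeSet (R : Set (Sym2 V)))),
        {(R : Set (Sym2 V))} := by
    ext s
    simp only [Set.mem_ofPred_eq, Set.mem_preimage, Set.mem_iUnion, Finset.mem_filter,
      Finset.mem_powerset, Set.mem_singleton_iff, exists_prop]
    constructor
    · rintro ⟨hs, hsX⟩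
      exact ⟨s.toFinset, ⟨fun x hx => hsX (by simpa using hx), by simpa using hs⟩, by simp⟩
    · rintro ⟨R, ⟨hR, hQR⟩, rfl⟩
      exact ⟨hQR, Finset.coe_subset.2 hR⟩
  rw [hset, measureReal_biUnion_finset (fun R _ R' _ h => by simpa using h)
    (fun R _ => (Set.toFinite _).measurableSet), average, Finset.sum_filter]
  refine Finset.sum_congr rfl fun R hR => ?_
  split_ifs
  · rw [setBernoulli_real_singleton p (Finset.coe_subset.2 (Finset.mem_powerset.1 hR))
      (Set.toFinite _), Set.ncard_coe_finset, mul_one, ← Finset.coe_sdiff, Set.ncard_coe_finset]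
  · rw [mul_zero]

/-- Every edge set whose graph has `P` contains a winning set. -/
lemma exists_winningSet_subset {P : SimpleGraph V → Prop} {G : SimpleGraph V}
    {T : Finset (Sym2 V)} (hT : (T : Set (Sym2 V)) ⊆ G.edgeSet)
    (h : P (SimpleGraph.fromEdgeSet (T : Set (Sym2 V)))) : ∃ W ∈ winningSets P G, W ⊆ T := by
  classical
  have hle : SimpleGraph.fromEdgeSet (T : Set (Sym2 V)) ≤ G := by
    rw [← SimpleGraph.edgeSet_subset_edgeSet, edgeSet_fromEdgeSet_of_subset hT]; exact hT
  obtain ⟨H, hHT, hH⟩ := (Set.toFinite {K : SimpleGraph V | K ≤ G ∧ P K}).exists_le_minimal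
    (show _ ∈ {K : SimpleGraph V | K ≤ G ∧ P K} from ⟨hle, h⟩)
  refine ⟨H.edgeFinset, ⟨H, hH, by simp⟩, fun e he => ?_⟩
  have h2 := SimpleGraph.edgeSet_subset_edgeSet.2 hHT
  rw [edgeSet_fromEdgeSet_of_subset hT] at h2
  simpa using h2 (by simpa using he)

/-- If the graph with edge set `A` has large local resilience, then `P` survives the deletion of
few edges at each vertex. -/
lemma property_sdiff_of_lt_localResilience [DecidableEq V] {P : SimpleGraph V → Prop}
    {G : SimpleGraph V} {A Y : Finset (Sym2 V)} (hA : (A : Set (Sym2 V)) ⊆ G.edgeSet) {r : ℝ}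
    (hr0 : 0 ≤ r) (hr1 : r ≤ 1)
    (hr : r < localResilience P (SimpleGraph.fromEdgeSet (A : Set (Sym2 V))))
    (hdeg : ∀ v, (edgeDegree (A ∩ Y) v : ℝ) ≤ r * edgeDegree A v) :
    P (SimpleGraph.fromEdgeSet ((A \ Y : Finset (Sym2 V)) : Set (Sym2 V))) := by
  classical
  by_contra hP
  have hAY : ((A ∩ Y : Finset (Sym2 V)) : Set (Sym2 V)) ⊆ G.edgeSet := by
    rw [Finset.coe_inter]; exact Set.inter_subset_left.trans hA
  refine hr.not_ge (csInf_le ⟨0, fun r hr => hr.1⟩ ⟨hr0, hr1,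
    SimpleGraph.fromEdgeSet ((A ∩ Y : Finset (Sym2 V)) : Set (Sym2 V)), ?_, fun v => ?_, ?_⟩)
  · exact SimpleGraph.fromEdgeSet_mono (by simp)
  · rw [degree_eq_edgeDegree (edgeSet_fromEdgeSet_of_subset hA).symm,
      degree_eq_edgeDegree (edgeSet_fromEdgeSet_of_subset hAY).symm]
    exact hdeg v
  · rwa [← SimpleGraph.fromEdgeSet_sdiff, ← Finset.coe_sdiff, Finset.sdiff_inter_self_left]

end RandomSubgraph

/-! ### The probability estimates -/

section Estimates

lemma natCast_pow_le_exp {a x : ℝ} (ha : 0 ≤ 1 + a) (d : ℕ) (hx : a * d ≤ x) :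
    (1 + a) ^ d ≤ Real.exp x := by
  calc (1 + a) ^ d ≤ Real.exp a ^ d := by
        gcongr; have := Real.add_one_le_exp a; linarith
    _ = Real.exp (a * d) := by rw [← Real.exp_nat_mul]; ring_nf
    _ ≤ _ := Real.exp_le_exp.2 hx

lemma two_rpow_le_exp {y x : ℝ} (h : Real.log 2 * y ≤ x) : (2 : ℝ) ^ y ≤ Real.exp x := by
  rw [Real.rpow_def_of_pos two_pos]; exact Real.exp_le_exp.2 h

/-- The upper tail of the degrees. -/
lemma upperTail_le {p L : ℝ} {d : ℕ} (hp : 0 ≤ p) (hL : 0 ≤ L) (hd : 1000 * L ≤ p * d) :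
    (1 - p + p * 2) ^ d * (2 : ℝ) ^ (-(8 / 5 * p * d)) ≤ Real.exp (-(3 / 2 * L)) := by
  have h2 := Real.log_two_gt_d9
  have h3 : 1 - p + p * 2 = 1 + p := by ring
  rw [h3]
  calc _ ≤ Real.exp (p * d) * Real.exp (-(0.69 * (8 / 5 * p * d))) := by
        gcongr
        · exact natCast_pow_le_exp (by linarith) d le_rfl
        · exact two_rpow_le_exp (by nlinarith)
    _ ≤ _ := by rw [← Real.exp_add]; exact Real.exp_le_exp.2 (by nlinarith)

/-- The lower tail of the degrees. -/
lemma lowerTail_le {p L : ℝ} {d : ℕ} (hp1 : p ≤ 1) (hL : 0 ≤ L)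
    (hd : 1000 * L ≤ p * d) :
    (1 - p + p * (1 / 2)) ^ d * (2 : ℝ) ^ (2 / 3 * p * d) ≤ Real.exp (-(3 / 2 * L)) := by
  have h2 := Real.log_two_lt_d9
  have h3 : 1 - p + p * (1 / 2) = 1 + -(p / 2) := by ring
  rw [h3]
  calc _ ≤ Real.exp (-(p / 2) * d) * Real.exp (0.7 * (2 / 3 * p * d)) := by
        gcongr
        · exact natCast_pow_le_exp (by linarith) d le_rfl
        · exact two_rpow_le_exp (by nlinarith)
    _ ≤ _ := by rw [← Real.exp_add]; exact Real.exp_le_exp.2 (by nlinarith)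

/-- The upper tail of the number of successes among the exposures of Breaker's edges. -/
lemma wastedTail_le {p ε L d : ℝ} (hp : 0 ≤ p) (hL : 0 ≤ L) (hε : 0 ≤ ε) (hd0 : 0 ≤ d)
    (hd : 10 * L ≤ ε * (p * d)) :
    (2 : ℝ) ^ (-(3 / 5 * ε * p * d)) * (1 + p) ^ (ε * d / 4) ≤ Real.exp (-(3 / 2 * L)) := by
  have h2 := Real.log_two_gt_d9
  have hx : 0 ≤ ε * p * d := by positivity
  calc _ ≤ Real.exp (-(0.69 * (3 / 5 * ε * p * d))) * Real.exp (p * (ε * d / 4)) := by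
        gcongr
        · exact two_rpow_le_exp (by nlinarith)
        · rw [Real.rpow_def_of_pos (by linarith)]
          refine Real.exp_le_exp.2 (mul_le_mul_of_nonneg_right ?_ (by positivity))
          have := Real.log_le_sub_one_of_pos (show 0 < 1 + p by linarith)
          linarith
    _ ≤ _ := by rw [← Real.exp_add]; exact Real.exp_le_exp.2 (by nlinarith)

lemma tendsto_natCast_mul_exp_neg_log :
    Tendsto (fun n : ℕ => 3 * ((n : ℝ) * Real.exp (-(3 / 2 * Real.log n)))) atTop (𝓝 0) := by
  have h := ((tendsto_rpow_neg_atTop (y := 1 / 2) (by norm_num)).comp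
    (tendsto_natCast_atTop_atTop (R := ℝ))).const_mul 3
  rw [mul_zero] at h
  refine h.congr' ?_
  filter_upwards [eventually_gt_atTop 0] with n hn
  have hn : (0 : ℝ) < n := by exact_mod_cast hn
  rw [Function.comp_apply, Real.rpow_def_of_pos hn]
  nth_rw 2 [← Real.exp_log hn]
  rw [← Real.exp_add]
  ring_nf

end Estimates

/-! ### The game on a graph with large minimum degree -/

section MinDegree

variable {V : Type*} [Fintype V] [DecidableEq V]

/-- The penalty of a set `R` of edges.  It is at least `1` if its graph does not have local
resilience `ε`, or if the degree of some vertex `v` exceeds `8 / 5 * p * deg v` or is less than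
`2 / 3 * p * deg v`. -/
noncomputable def penalty (P : SimpleGraph V → Prop) (X : Finset (Sym2 V)) (p ε : ℝ)
    (R : Finset (Sym2 V)) : ℝ :=
  (1 - if ε ≤ localResilience P (SimpleGraph.fromEdgeSet (R : Set (Sym2 V))) then 1 else 0) +
    ∑ v, (2 ^ edgeDegree R v * (2 : ℝ) ^ (-(8 / 5 * p * edgeDegree X v)) +
      (1 / 2) ^ edgeDegree R v * (2 : ℝ) ^ (2 / 3 * p * edgeDegree X v))

variable {P : SimpleGraph V → Prop} {X R : Finset (Sym2 V)} {p ε : ℝ}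

lemma penalty_nonneg : 0 ≤ penalty P X p ε R := by
  refine add_nonneg ?_ (Finset.sum_nonneg fun v _ => by positivity)
  split_ifs <;> norm_num

lemma le_localResilience_of_penalty_lt_one (h : penalty P X p ε R < 1) :
    ε ≤ localResilience P (SimpleGraph.fromEdgeSet (R : Set (Sym2 V))) := by
  by_contra hne
  rw [penalty, if_neg hne] at h
  have : 0 ≤ ∑ v, (2 ^ edgeDegree R v * (2 : ℝ) ^ (-(8 / 5 * p * edgeDegree X v)) +
      (1 / 2) ^ edgeDegree R v * (2 : ℝ) ^ (2 / 3 * p * edgeDegree X v)) :=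
    Finset.sum_nonneg fun v _ => by positivity
  linarith

lemma edgeDegree_bounds_of_penalty_lt_one (h : penalty P X p ε R < 1) (v : V) :
    2 / 3 * p * edgeDegree X v < edgeDegree R v ∧
      (edgeDegree R v : ℝ) < 8 / 5 * p * edgeDegree X v := by
  have h1 : 2 ^ edgeDegree R v * (2 : ℝ) ^ (-(8 / 5 * p * edgeDegree X v)) +
      (1 / 2) ^ edgeDegree R v * (2 : ℝ) ^ (2 / 3 * p * edgeDegree X v) < 1 := by
    refine lt_of_le_of_lt ((Finset.single_le_sum (f := fun v => 2 ^ edgeDegree R v *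
      (2 : ℝ) ^ (-(8 / 5 * p * edgeDegree X v)) +
      (1 / 2) ^ edgeDegree R v * (2 : ℝ) ^ (2 / 3 * p * edgeDegree X v))
      (fun v _ => by positivity) (Finset.mem_univ v)).trans (le_add_of_nonneg_left ?_)) h
    split_ifs <;> norm_num
  have h2 : 0 < 2 ^ edgeDegree R v * (2 : ℝ) ^ (-(8 / 5 * p * edgeDegree X v)) := by positivity
  have h3 : 0 < (1 / 2) ^ edgeDegree R v * (2 : ℝ) ^ (2 / 3 * p * edgeDegree X v) := by positivity
  constructor
  · have h4 : (2 : ℝ) ^ (2 / 3 * p * edgeDegree X v - (edgeDegree R v : ℝ)) < 1 := by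
      rw [sub_eq_neg_add, Real.rpow_add two_pos, Real.rpow_neg two_pos.le, Real.rpow_natCast]
      rw [one_div, inv_pow] at h1 h3
      linarith
    by_contra! hge
    exact absurd h4 (not_lt.2 (Real.one_le_rpow one_le_two (by linarith)))
  · have h4 : (2 : ℝ) ^ ((edgeDegree R v : ℝ) - 8 / 5 * p * edgeDegree X v) < 1 := by
      rw [sub_eq_add_neg, Real.rpow_add two_pos, Real.rpow_natCast]
      linarith
    by_contra! hge
    exact absurd h4 (not_lt.2 (Real.one_le_rpow one_le_two (by linarith)))

lemma average_penalty (P : SimpleGraph V → Prop) {G : SimpleGraph V}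
    (hX : (X : Set (Sym2 V)) = G.edgeSet) (p : unitInterval) (ε : ℝ) :
    average (p : ℝ) X (penalty P X p ε) = (1 - resilienceProb P G p ε) +
      ∑ v, ((1 - (p : ℝ) + p * 2) ^ edgeDegree X v *
          (2 : ℝ) ^ (-(8 / 5 * (p : ℝ) * edgeDegree X v)) +
        (1 - (p : ℝ) + p * (1 / 2)) ^ edgeDegree X v *
          (2 : ℝ) ^ (2 / 3 * (p : ℝ) * edgeDegree X v)) := by
  have h1 := average_add (p : ℝ) X
    (fun R => 1 -
      if ε ≤ localResilience P (SimpleGraph.fromEdgeSet (R : Set (Sym2 V))) then 1 else 0)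
    (fun R => if ε ≤ localResilience P (SimpleGraph.fromEdgeSet (R : Set (Sym2 V))) then 1 else 0)
  simp only [sub_add_cancel, average_const] at h1
  unfold penalty
  rw [resilienceProb, randomSubgraph_real_eq_average hX, average_add, average_sum,
    ← eq_sub_of_add_eq h1.symm]
  simp only [average_add, average_mul_const, average_pow_edgeDegree]

end MinDegree

/-- The theorem for a single graph, with an explicit condition on the error probability. -/
theorem makerWinsOn_of_resilienceProb {V : Type*} [Fintype V] {ε : ℝ} (G : SimpleGraph V)
    [DecidableRel G.Adj] (p : unitInterval) (P : SimpleGraph V → Prop) (hε0 : 0 < ε)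
    (hε1 : ε ≤ 1 / 100) (hp0 : 0 < p)
    (hlog : 1 ≤ Real.log (Fintype.card V))
    (hres : 1 - resilienceProb P G p ε +
      3 * ((Fintype.card V : ℝ) * Real.exp (-(3 / 2 * Real.log (Fintype.card V)))) < 1)
    (hdeg : 10 * Real.log (Fintype.card V) / (ε * (p : ℝ)) ≤ (G.minDegree : ℝ)) :
    MakerWinsOn P G 1 ⌊ε / (20 * (p : ℝ))⌋₊ := by
  classical
  have hp : (0 : ℝ) < p := hp0
  have hp1 : (p : ℝ) ≤ 1 := p.2.2
  set L := Real.log (Fintype.card V) with hLdef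
  set X : Finset (Sym2 V) := G.edgeFinset with hX
  have hd : ∀ v, 10 * L ≤ ε * (p * edgeDegree X v) := by
    intro v
    have h1 : (G.minDegree : ℝ) ≤ edgeDegree X v := by
      rw [← degree_eq_edgeDegree (H := G) (by simp [hX]) v]
      exact_mod_cast G.minDegree_le_degree v
    have h2 := hdeg.trans h1
    rw [div_le_iff₀ (by positivity)] at h2
    linarith
  have hd' : ∀ v, 1000 * L ≤ p * edgeDegree X v := by
    intro v
    have h0 : 0 ≤ (p : ℝ) * edgeDegree X v := by positivity
    nlinarith [hd v]
  have hfE : ∀ T ⊆ X, (T : Set (Sym2 V)) ⊆ G.edgeSet := fun T hT x hx => by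
    simpa [hX] using hT (by simpa using hx)
  unfold MakerWinsOn
  have key : MakerWins X (winningSets P G) 1 ⌊ε / (20 * (p : ℝ))⌋₊ := by
    refine makerWins_of_failureEstimate_lt_one (p := p) (β := ε / (20 * p))
      (f := penalty P X p ε) (D := fun v => 8 / 5 * p * edgeDegree X v)
      (K := fun v => ε * edgeDegree X v / 4) (t := fun v => 3 / 5 * ε * p * edgeDegree X v)
      hp.le hp1 (by positivity) (Nat.floor_le (by positivity)) (fun _ => penalty_nonneg)
      (fun v => by positivity)
      (fun A _ hA v => (edgeDegree_bounds_of_penalty_lt_one hA v).2.le) ?_ ?_ ?_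
    · intro v
      -- `3 * β * D v` is `6 / 25 * ε * d(v)`; the degree condition makes the rest negligible.
      have h1 : 4 * (ε / (20 * p)) * L + ε / (20 * p) +
          3 * (ε / (20 * p)) * (8 / 5 * p * edgeDegree X v) =
          ε / p * ((4 * L + 1) / 20) + 6 / 25 * ε * edgeDegree X v := by
        field_simp; ring
      have h2 : L / p ≤ ε * edgeDegree X v / 10 := by
        rw [div_le_iff₀ hp]; linarith [hd v]
      have h3 : ε / p * ((4 * L + 1) / 20) ≤ ε * (L / p) / 4 := by
        calc ε / p * ((4 * L + 1) / 20) ≤ ε / p * (L / 4) := by gcongr ε / p * ?_; linarith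
          _ = ε * (L / p) / 4 := by ring
      have h4 : ε * (L / p) ≤ ε * (ε * edgeDegree X v / 10) := by gcongr
      have h5 : ε * (ε * edgeDegree X v / 10) ≤ 1 / 100 * (ε * edgeDegree X v / 10) := by gcongr
      have h6 : 0 ≤ ε * edgeDegree X v := by positivity
      rw [← hLdef, h1]
      linarith
    · rw [failureEstimate]
      simp only [Finset.sdiff_empty, Finset.empty_union, Finset.empty_inter, edgeDegree_empty,
        pow_zero, div_one, one_mul]
      rw [average_penalty P (G := G) (by simp [hX]), add_assoc, ← Finset.sum_add_distrib]
      refine lt_of_le_of_lt (add_le_add_right (Finset.sum_le_card_nsmul _ _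
        (3 * Real.exp (-(3 / 2 * L))) fun v _ => ?_) _) (lt_of_eq_of_lt ?_ hres)
      · have h1 := upperTail_le hp.le (by linarith) (hd' v)
        have h2 := lowerTail_le hp1 (by linarith) (hd' v)
        have h3 := wastedTail_le hp.le (by linarith) hε0.le (Nat.cast_nonneg _) (hd v)
        linarith
      · rw [nsmul_eq_mul, Finset.card_univ]; ring
    · intro A Y hA hfA ht
      refine exists_winningSet_subset (hfE _ (Finset.sdiff_subset.trans hA)) ?_
      have hr := le_localResilience_of_penalty_lt_one hfA
      -- The infimum `localResilience` only excludes ratios strictly below `ε`; the ratio is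
      -- `(3 / 5) / (2 / 3) = 9 / 10` of it.
      refine property_sdiff_of_lt_localResilience (hfE A hA) (r := 9 / 10 * ε) (by positivity)
        (by linarith) (by linarith) fun v => ?_
      have h1 := (edgeDegree_bounds_of_penalty_lt_one hfA v).1
      have h2 := ht v
      nlinarith
  convert key

end MakerBreaker

/-- The first part is the statement for a sequence of graphs and probabilities.  The second part
says that how large `n` has to be depends only on `ε` and on the rate `η` at which the probabilities
in the definition of resilience tend to `1`, and not on the graph, the edge probability and the
property. -/
theorem theorem1p4 (ε : ℝ) (hε0 : 0 < ε) (hε1 : ε ≤ 1 / 100) :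
    (∀ (V : ℕ → Type*) [∀ n, Fintype (V n)] (G : ∀ n, SimpleGraph (V n))
        [∀ n, DecidableRel (G n).Adj] (p : ℕ → unitInterval)
        (P : ∀ n, SimpleGraph (V n) → Prop),
      (∀ n, Fintype.card (V n) = n) →
      (∀ n, 0 < p n ∧ p n < 1) →
      (∀ n, MakerBreaker.MonotoneIncreasing (P n)) →
      MakerBreaker.IsResilient P G p ε →
      ∀ᶠ n : ℕ in atTop,
        10 * Real.log n / (ε * (p n : ℝ)) ≤ ((G n).minDegree : ℝ) →
        MakerBreaker.MakerWinsOn (P n) (G n) 1 ⌊ε / (20 * (p n : ℝ))⌋₊) ∧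
    (∀ η : ℕ → ℝ, Tendsto η atTop (𝓝 0) → ∃ n₀ : ℕ, ∀ n ≥ n₀,
      ∀ (V : Type*) [Fintype V] (G : SimpleGraph V) [DecidableRel G.Adj] (p : unitInterval)
        (P : SimpleGraph V → Prop),
      Fintype.card V = n →
      0 < p → p < 1 →
      MakerBreaker.MonotoneIncreasing P →
      1 - η n ≤ MakerBreaker.resilienceProb P G p ε →
      10 * Real.log n / (ε * (p : ℝ)) ≤ (G.minDegree : ℝ) →
      MakerBreaker.MakerWinsOn P G 1 ⌊ε / (20 * (p : ℝ))⌋₊) := by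
  have hlog : ∀ᶠ n : ℕ in atTop, 1 ≤ Real.log n :=
    (Real.tendsto_log_atTop.comp tendsto_natCast_atTop_atTop).eventually_ge_atTop 1
  have hsmall : ∀ η : ℕ → ℝ, Tendsto η atTop (𝓝 0) → ∀ᶠ n : ℕ in atTop,
      η n + 3 * ((n : ℝ) * Real.exp (-(3 / 2 * Real.log n))) < 1 := fun η hη => by
    have h := hη.add MakerBreaker.tendsto_natCast_mul_exp_neg_log
    rw [add_zero] at h
    exact h.eventually_lt_const one_pos
  constructor
  · intro V _ G _ p P hV hp _ hres
    have hη : Tendsto (fun n => 1 - MakerBreaker.resilienceProb (P n) (G n) (p n) ε) atTop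
        (𝓝 0) := by
      simpa using hres.const_sub 1
    filter_upwards [hlog, hsmall _ hη] with n hn hs hdeg
    exact MakerBreaker.makerWinsOn_of_resilienceProb (G n) (p n) (P n) hε0 hε1 (hp n).1
      (by rwa [hV]) (by rwa [hV]) (by rwa [hV])
  · intro η hη
    obtain ⟨n₀, h⟩ := eventually_atTop.1 (hlog.and (hsmall η hη))
    refine ⟨n₀, fun n hn V _ G _ p P hV hp _ _ hres hdeg => ?_⟩
    obtain ⟨hn1, hs⟩ := h n hn
    subst hV
    exact MakerBreaker.makerWinsOn_of_resilienceProb G p P hε0 hε1 hp hn1 (by linarith) hdeg
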